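/- For a finite simple graph $G$ let $I(G,x)=\sum_{j\ge 0}s(G,j)x^j$ be its independence polynomial, where $s(G,j)$ is the number of independent sets of $G$ of size $j$, and let $\xi(G)$ be the largest real root of $I(G,x)$. Write $G\succeq H$ if $\xi(G)$ exists and $I(H,x)\ge I(G,x)$ for every $x\in[\xi(G),0]$, and $G\succ H$ if $G\succeq H$ and $I(G,x)\ne I(H,x)$. For integers $n_1,\ldots,n_k\ge 2$ let $T(n_1,\ldots,n_k)$ be the tree, unique up to isomorphism, consisting of a vertex $v$ joined to one end vertex of each of $k$ disjoint paths, the $i$-th of which has $n_i-1$ vertices. Theorem. Let $k\ge 1$, and let $n_1\ge\cdots\ge n_k\ge 2$ and $m_1\ge\cdots\ge m_k\ge 2$ be integers such that $T(n_1,\ldots,n_k)$ and $T(m_1,\ldots,m_k)$ have the same number of vertices. 1. If $\sum_{i=1}^{j}n_i\ge\sum_{i=1}^{j}m_i$ for every $j=1,\ldots,k$, then $T(m_1,\ldots,m_k)\succeq T(n_1,\ldots,n_k)$. 2. If moreover $k\ge 3$ and $(n_1,\ldots,n_k)\ne(m_1,\ldots,m_k)$, then $T(m_1,\ldots,m_k)\succ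 T(n_1,\ldots,n_k)$. -/

import Mathlib

namespace StarlikeTrees

open Polynomial

open Classical in
/-- The independence polynomial `I(G, x) = ∑ₖ s(G, k) xᵏ`, where `s(G, k)` is the number of
independent sets of size `k` of the finite simple graph `G`. -/
noncomputable def indepPoly {V : Type*} [Fintype V] (G : SimpleGraph V) : ℝ[X] :=
  ∑ k ∈ Finset.range (Fintype.card V + 1), C ((G.indepSetFinset k).card : ℝ) * X ^ k

/-- `ξ` is the largest real root of the independence polynomial of `G`. -/
def IsLargestRealRoot {V : Type*} [Fintype V] (G : SimpleGraph V) (ξ : ℝ) : Prop :=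
  IsGreatest {x : ℝ | (indepPoly G).IsRoot x} ξ

/-- `G ⪰ H`: the largest real root `ξ(G)` exists, and `I(H, x) ≥ I(G, x)` for every `x` in the
interval `[ξ(G), 0]`. -/
def GraphGE {V W : Type*} [Fintype V] [Fintype W] (G : SimpleGraph V) (H : SimpleGraph W) :
    Prop :=
  ∃ ξ : ℝ, IsLargestRealRoot G ξ ∧
    ∀ x ∈ Set.Icc ξ 0, (indepPoly G).eval x ≤ (indepPoly H).eval x

/-- `G ≻ H`: `G ⪰ H` and the independence polynomials of `G` and `H` are different. -/
def GraphGT {V W : Type*} [Fintype V] [Fintype W] (G : SimpleGraph V) (H : SimpleGraph W) :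
    Prop :=
  GraphGE G H ∧ indepPoly G ≠ indepPoly H

/-- `X ⪰_d Y`: every partial sum `x₁ + ⋯ + x_j` is at least `y₁ + ⋯ + y_j`. -/
def Dominates {α : Type*} [AddCommMonoid α] [LE α] {k : ℕ} (X Y : Fin k → α) : Prop :=
  ∀ j : Fin k, ∑ i ∈ Finset.Iic j, Y i ≤ ∑ i ∈ Finset.Iic j, X i

/-- `X ≻_d Y`: `X ⪰_d Y` and `X ≠ Y`. -/
def StrictlyDominates {α : Type*} [AddCommMonoid α] [LE α] {k : ℕ} (X Y : Fin k → α) : Prop :=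
  Dominates X Y ∧ X ≠ Y

/-- The vertices of `T(n₁, …, n_k)`: the centre `none`, and `n i - 1` vertices on the `i`-th arm,
where `some ⟨i, a⟩` has distance `a + 1` from the centre. -/
abbrev StarlikeVertex {k : ℕ} (n : Fin k → ℕ) : Type :=
  Option (Σ i : Fin k, Fin (n i - 1))

/-- Each edge of `T(n₁, …, n_k)`, directed away from the centre. -/
def StarlikeStep {k : ℕ} (n : Fin k → ℕ) : StarlikeVertex n → StarlikeVertex n → Prop
  | none, some p => (p.2 : ℕ) = 0
  | some p, some q => p.1 = q.1 ∧ (q.2 : ℕ) = p.2 + 1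
  | _, none => False

/-- The tree `T(n₁, …, n_k)` (for `n i ≥ 2`): a centre joined to one end vertex of each of `k`
disjoint paths, the `i`-th of which has `n i - 1` vertices. -/
def starlikeTree {k : ℕ} (n : Fin k → ℕ) : SimpleGraph (StarlikeVertex n) :=
  SimpleGraph.fromRel (StarlikeStep n)

end StarlikeTrees

/-! Write q_N for `pathValue x N`. Conditioning on the centre gives I(T(n), x) = ∏ q_{n_i} + x ∏
q_{n_i - 1} (`eval_indepPoly_starlikeTree`). Moving one unit from an entry m_j to an entry m_i ≥ m_j
changes this by (-x)^{m_j} q_{m_i - m_j} (∏ q_{m_l - 1} - ∏ q_{m_l}), with products over l ≠ i, j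
(`starValue_transfer_sub`, from a Cassini identity).

Where I(T(m), ·) is nonnegative up to 0, all q_{m_l} are positive, and q_N - q_{N-1} = x q_{N-2}
makes the change nonnegative; it is strictly positive for x < 0 once a third arm exists. Finitely
many such moves lead from m to any admissible n dominating it (`exists_transfer`), and nonnegativity
survives each move. -/

namespace StarlikeTrees

/-! ### Path polynomials -/

/-- The recursion `q₀ = q₁ = 1`, `q_{N+2} = q_{N+1} + x q_N`; `q_{N+1}` is the value at `x` of the
independence polynomial of the path on `N` vertices. -/
def pathValue (x : ℝ) : ℕ → ℝ
  | 0 => 1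
  | 1 => 1
  | N + 2 => pathValue x (N + 1) + x * pathValue x N

/-- The value at `x` of the independence polynomial of `T(n₁, …, n_k)`, as a polynomial in
path values. -/
def starValue {k : ℕ} (n : Fin k → ℕ) (x : ℝ) : ℝ :=
  ∏ i, pathValue x (n i) + x * ∏ i, pathValue x (n i - 1)

theorem pathValue_add_two (x : ℝ) (N : ℕ) :
    pathValue x (N + 2) = pathValue x (N + 1) + x * pathValue x N := by
  rw [pathValue]

theorem pathValue_zero_left (N : ℕ) : pathValue 0 N = 1 := by
  induction N using Nat.twoStepInduction with
  | zero => rw [pathValue]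
  | one => rw [pathValue]
  | more N h0 h1 => rw [pathValue_add_two, h1]; ring

theorem continuous_pathValue (N : ℕ) : Continuous fun x => pathValue x N := by
  induction N using Nat.twoStepInduction with
  | zero => simpa only [pathValue] using continuous_const
  | one => simpa only [pathValue] using continuous_const
  | more N h0 h1 =>
    simp only [pathValue_add_two]
    fun_prop

theorem pathValue_pos_of_nonneg {x : ℝ} (hx : 0 ≤ x) (N : ℕ) : 0 < pathValue x N := by
  induction N using Nat.twoStepInduction with
  | zero => simp [pathValue]
  | one => simp [pathValue]
  | more N h0 h1 => rw [pathValue_add_two]; positivity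

/-- Expanding the two highest-index factors by the recursion shows that raising `b` by one
multiplies the left side by `-x`. -/
theorem pathValue_cassini (x : ℝ) (b c : ℕ) :
    pathValue x (b + 1 + c + 1) * pathValue x b - pathValue x (b + 1 + c) * pathValue x (b + 1) =
      -(-x) ^ (b + 1) * pathValue x c := by
  induction b with
  | zero =>
    have h := pathValue_add_two x c
    rw [show 0 + 1 + c + 1 = c + 2 by ring, show 0 + 1 + c = c + 1 by ring, h]
    simp only [pathValue]
    ring
  | succ b ih =>
    have h1 := pathValue_add_two x (b + 1 + c)
    have h2 := pathValue_add_two x b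
    rw [show b + 1 + 1 + c + 1 = b + 1 + c + 2 by ring, h1,
      show b + 1 + 1 + c = b + 1 + c + 1 by ring, show b + 1 + 1 = b + 2 by ring, h2]
    linear_combination (-x) * ih

theorem exists_last_zero {f : ℝ → ℝ} (hf : Continuous f) (h0 : 0 < f 0) {y : ℝ} (hy : y ≤ 0)
    (hfy : f y ≤ 0) :
    ∃ w, y ≤ w ∧ w < 0 ∧ f w = 0 ∧ ∀ z, w < z → z ≤ 0 → 0 < f z := by
  have hK : IsCompact (Set.Icc y 0 ∩ {z | f z ≤ 0}) :=
    isCompact_Icc.inter_right (isClosed_le hf continuous_const)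
  obtain ⟨w, ⟨⟨hyw, hw0⟩, hfw⟩, hmax⟩ := hK.exists_isGreatest ⟨y, ⟨le_rfl, hy⟩, hfy⟩
  have hpos : ∀ z, w < z → z ≤ 0 → 0 < f z := by
    intro z hwz hz
    by_contra! h
    exact absurd (hmax ⟨⟨hyw.trans hwz.le, hz⟩, h⟩) (not_le.2 hwz)
  have hw : w < 0 := by
    refine lt_of_le_of_ne hw0 ?_
    rintro rfl
    exact absurd hfw (not_le.2 h0)
  obtain ⟨u, ⟨hwu, hu0⟩, hfu⟩ := intermediate_value_Icc hw0 hf.continuousOn ⟨hfw, h0.le⟩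
  refine ⟨w, hyw, hw, ?_, hpos⟩
  rcases eq_or_lt_of_le hwu with rfl | h
  · exact hfu
  · exact absurd hfu (hpos u h hu0).ne'

/-- At the last zero w < 0 of q_{N+1} the recursion gives q_{N+2}(w) = w q_N(w), which is negative
by induction: the next path value turns negative before its predecessor can vanish. -/
theorem pathValue_pos_of_succ_nonneg (N : ℕ) {y : ℝ}
    (h : ∀ z ∈ Set.Icc y 0, 0 ≤ pathValue z (N + 1)) :
    ∀ z ∈ Set.Icc y 0, 0 < pathValue z N := by
  induction N generalizing y with
  | zero => intro z _; simp [pathValue]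
  | succ N ih =>
    intro z hz
    by_contra! hneg
    obtain ⟨w, hzw, hw0, hw, hpos⟩ := exists_last_zero (continuous_pathValue (N + 1))
      (by simp [pathValue_zero_left]) hz.2 hneg
    have h1 : 0 < pathValue w N := by
      refine ih (y := w) (fun u hu => ?_) w ⟨le_rfl, hw0.le⟩
      rcases eq_or_lt_of_le hu.1 with rfl | h
      · exact hw.ge
      · exact (hpos u h hu.2).le
    have h2 := h w ⟨hz.1.trans hzw, hw0.le⟩
    rw [pathValue_add_two, hw] at h2
    nlinarith

theorem pathValue_pos_of_le {M N : ℕ} (hMN : M ≤ N) {y : ℝ}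
    (h : ∀ z ∈ Set.Icc y 0, 0 < pathValue z N) :
    ∀ z ∈ Set.Icc y 0, 0 < pathValue z M := by
  induction N, hMN using Nat.le_induction with
  | base => exact h
  | succ N _ ih => exact ih (pathValue_pos_of_succ_nonneg N fun z hz => (h z hz).le)

/-! ### Star values under unit transfers -/

section StarValue

variable {k : ℕ}

theorem continuous_starValue (m : Fin k → ℕ) : Continuous (starValue m) := by
  have := continuous_pathValue
  unfold starValue
  fun_prop

theorem starValue_pos_of_nonneg (m : Fin k → ℕ) {x : ℝ} (hx : 0 ≤ x) : 0 < starValue m x := by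
  have h1 : 0 < ∏ i, pathValue x (m i) :=
    Finset.prod_pos fun i _ => pathValue_pos_of_nonneg hx _
  have h2 : 0 < ∏ i, pathValue x (m i - 1) :=
    Finset.prod_pos fun i _ => pathValue_pos_of_nonneg hx _
  unfold starValue
  positivity

theorem pathValue_pos_of_starValue_nonneg {m : Fin k → ℕ} (hm : ∀ i, 2 ≤ m i) {y : ℝ}
    (h : ∀ z ∈ Set.Icc y 0, 0 ≤ starValue m z) (i : Fin k) :
    ∀ z ∈ Set.Icc y 0, 0 < pathValue z (m i) := by
  have hcont : Continuous fun z => ∏ i, pathValue z (m i) := by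
    have := continuous_pathValue
    fun_prop
  intro z hz
  by_contra! hneg
  obtain ⟨v, hzv, hv0, hv, -⟩ := exists_last_zero (continuous_pathValue (m i))
    (by simp [pathValue_zero_left]) hz.2 hneg
  -- Taking the last zero of the whole product keeps every factor nonnegative on [w, 0] at once;
  -- then all predecessors are positive at w and `starValue m w` is negative.
  obtain ⟨w, hvw, hw0, hw, hpos⟩ := exists_last_zero hcont
    (by simp [pathValue_zero_left]) hv0.le (Finset.prod_eq_zero (Finset.mem_univ i) hv).le
  have hnn : ∀ l, ∀ u ∈ Set.Icc w 0, 0 ≤ pathValue u (m l) := by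
    intro l u hu
    by_contra! hlt
    obtain ⟨u', huu', hu'0, hu', -⟩ := exists_last_zero (continuous_pathValue (m l))
      (by simp [pathValue_zero_left]) hu.2 hlt.le
    have hwu' : w < u' := by
      refine lt_of_le_of_ne (hu.1.trans huu') ?_
      rintro rfl
      have : u = w := le_antisymm huu' hu.1
      rw [this, hu'] at hlt
      exact lt_irrefl _ hlt
    exact (hpos u' hwu' hu'0.le).ne' (Finset.prod_eq_zero (Finset.mem_univ l) hu')
  have hB : 0 < ∏ l, pathValue w (m l - 1) := by
    refine Finset.prod_pos fun l _ => ?_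
    refine pathValue_pos_of_succ_nonneg (m l - 1) ?_ w ⟨le_rfl, hw0.le⟩
    rw [Nat.sub_add_cancel (by linarith [hm l])]
    exact hnn l
  have hF := h w ⟨hz.1.trans (hzv.trans hvw), hw0.le⟩
  unfold starValue at hF
  rw [hw] at hF
  nlinarith

theorem exists_largest_zero_starValue {m : Fin k → ℕ} (hm : ∀ i, 2 ≤ m i) :
    ∃ ξ < 0, IsGreatest {x | starValue m x = 0} ξ ∧ ∀ z ∈ Set.Icc ξ 0, 0 ≤ starValue m z := by
  have hex : ∃ y ≤ 0, starValue m y ≤ 0 := by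
    rcases Nat.eq_zero_or_pos k with rfl | hk
    · exact ⟨-1, by norm_num, by simp [starValue]⟩
    · by_contra! hpos
      -- Otherwise positivity would descend to q_2 = 1 + x at x = -1, where it vanishes.
      have h1 := pathValue_pos_of_le (hm ⟨0, hk⟩)
        (pathValue_pos_of_starValue_nonneg (y := -1) hm (fun z hz => (hpos z hz.2).le) ⟨0, hk⟩)
        (-1) ⟨le_rfl, by norm_num⟩
      simp [pathValue] at h1
  obtain ⟨y, hy, hle⟩ := hex
  obtain ⟨ξ, -, h0, hξ, hpos⟩ := exists_last_zero (continuous_starValue m)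
    (starValue_pos_of_nonneg m le_rfl) hy hle
  refine ⟨ξ, h0, ⟨hξ, fun x hx => ?_⟩, fun z hz => ?_⟩
  · by_contra! hlt
    rcases le_total x 0 with h | h
    · exact (hpos x hlt h).ne' hx
    · exact (starValue_pos_of_nonneg m h).ne' hx
  · rcases eq_or_lt_of_le hz.1 with rfl | h
    · exact hξ.ge
    · exact (hpos z h hz.2).le

theorem prod_eq_mul_mul_prod_erase {i j : Fin k} (hij : i ≠ j) (f : Fin k → ℝ) :
    ∏ l, f l = f i * f j * ∏ l ∈ (Finset.univ.erase i).erase j, f l := by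
  rw [← Finset.mul_prod_erase _ f (Finset.mem_univ i),
    ← Finset.mul_prod_erase _ f (Finset.mem_erase.2 ⟨hij.symm, Finset.mem_univ j⟩), mul_assoc]

/-- Moving one unit from the entry `j` to the entry `i`. -/
def transfer (m : Fin k → ℕ) (i j : Fin k) : Fin k → ℕ :=
  Function.update (Function.update m i (m i + 1)) j (m j - 1)

theorem transfer_left (m : Fin k → ℕ) {i j : Fin k} (hij : i ≠ j) :
    transfer m i j i = m i + 1 := by
  simp [transfer, hij]

theorem transfer_right (m : Fin k → ℕ) (i j : Fin k) : transfer m i j j = m j - 1 := by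
  simp [transfer]

theorem transfer_of_ne (m : Fin k → ℕ) {i j l : Fin k} (hi : l ≠ i) (hj : l ≠ j) :
    transfer m i j l = m l := by
  simp [transfer, hi, hj]

theorem starValue_transfer_sub (m : Fin k → ℕ) {i j : Fin k} (hij : i ≠ j) (hj : 2 ≤ m j)
    (hle : m j ≤ m i) (x : ℝ) :
    starValue (transfer m i j) x - starValue m x =
      (-x) ^ m j * pathValue x (m i - m j) *
        (∏ l ∈ (Finset.univ.erase i).erase j, pathValue x (m l - 1) -
          ∏ l ∈ (Finset.univ.erase i).erase j, pathValue x (m l)) := by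
  have hS : ∀ g : ℕ → ℝ, ∏ l ∈ (Finset.univ.erase i).erase j, g (transfer m i j l) =
      ∏ l ∈ (Finset.univ.erase i).erase j, g (m l) := by
    intro g
    refine Finset.prod_congr rfl fun l hl => ?_
    simp only [Finset.mem_erase] at hl
    rw [transfer_of_ne m hl.2.1 hl.1]
  unfold starValue
  simp only [prod_eq_mul_mul_prod_erase hij]
  rw [hS (fun a => pathValue x a), hS (fun a => pathValue x (a - 1)), transfer_left m hij,
    transfer_right]
  obtain ⟨b, hb⟩ : ∃ b, m j = b + 2 := ⟨m j - 2, by omega⟩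
  obtain ⟨c, hc⟩ : ∃ c, m i = b + 2 + c := ⟨m i - m j, by omega⟩
  have h1 := pathValue_cassini x (b + 1) c
  have h2 := pathValue_cassini x b c
  rw [hb, hc, show b + 2 - 1 - 1 = b by omega, show b + 2 - 1 = b + 1 by omega,
    show b + 2 + c + 1 - 1 = b + 1 + c + 1 by omega, show b + 2 + c - 1 = b + 1 + c by omega,
    show b + 2 + c - (b + 2) = c by omega]
  rw [show b + 1 + 1 = b + 2 by ring] at h1
  set A := ∏ l ∈ (Finset.univ.erase i).erase j, pathValue x (m l)
  set B := ∏ l ∈ (Finset.univ.erase i).erase j, pathValue x (m l - 1)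
  -- The second identity has one factor -x fewer; the extra x restores it and flips the sign.
  linear_combination A * h1 + x * B * h2

theorem pathValue_le_pred {y z : ℝ} {N : ℕ} (hN : 2 ≤ N)
    (h : ∀ z ∈ Set.Icc y 0, 0 < pathValue z N) (hz : z ∈ Set.Icc y 0) :
    pathValue z N ≤ pathValue z (N - 1) ∧ (z < 0 → pathValue z N < pathValue z (N - 1)) := by
  have h2 := pathValue_pos_of_le (Nat.sub_le N 2) h z hz
  obtain ⟨M, rfl⟩ : ∃ M, N = M + 2 := ⟨N - 2, by omega⟩
  rw [Nat.add_sub_cancel] at h2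
  rw [pathValue_add_two, show M + 2 - 1 = M + 1 by omega]
  exact ⟨by nlinarith [hz.2], fun hz0 => by nlinarith⟩

theorem starValue_le_transfer {m : Fin k → ℕ} (hm : ∀ i, 2 ≤ m i) {y : ℝ}
    (h : ∀ z ∈ Set.Icc y 0, 0 ≤ starValue m z) {i j : Fin k} (hij : i ≠ j) (hle : m j ≤ m i)
    {z : ℝ} (hz : z ∈ Set.Icc y 0) :
    starValue m z ≤ starValue (transfer m i j) z ∧
      (3 ≤ k → z < 0 → starValue m z < starValue (transfer m i j) z) := by
  have hpos := pathValue_pos_of_starValue_nonneg hm h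
  have hc : 0 < pathValue z (m i - m j) := pathValue_pos_of_le (Nat.sub_le _ _) (hpos i) z hz
  have hsub := starValue_transfer_sub m hij (hm j) hle z
  have hAB : ∏ l ∈ (Finset.univ.erase i).erase j, pathValue z (m l) ≤
      ∏ l ∈ (Finset.univ.erase i).erase j, pathValue z (m l - 1) :=
    Finset.prod_le_prod (fun l _ => (hpos l z hz).le)
      fun l _ => (pathValue_le_pred (hm l) (hpos l) hz).1
  constructor
  · have : 0 ≤ (-z) ^ m j := pow_nonneg (by linarith [hz.2]) _
    have := mul_nonneg (mul_nonneg this hc.le) (sub_nonneg.2 hAB)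
    linarith
  · intro hk hz0
    -- For k = 2 both remaining products are empty and the transfer changes nothing, hence 3 ≤ k.
    have hne : ((Finset.univ.erase i).erase j).Nonempty := by
      rw [← Finset.card_pos, Finset.card_erase_of_mem (by simp [hij.symm]),
        Finset.card_erase_of_mem (by simp)]
      simp
      omega
    have hlt := Finset.prod_lt_prod_of_nonempty
      (fun l _ => hpos l z hz)
      (fun l _ => (pathValue_le_pred (hm l) (hpos l) hz).2 hz0) hne
    have : 0 < (-z) ^ m j := pow_pos (by linarith) _
    have := mul_pos (mul_pos this hc) (sub_pos.2 hlt)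
    linarith

/-! ### Dominance by unit transfers -/

theorem sum_Iic_transfer (m : Fin k → ℕ) {i j : Fin k} (hij : i < j) (hj : 1 ≤ m j) (l : Fin k) :
    ∑ a ∈ Finset.Iic l, transfer m i j a =
      ∑ a ∈ Finset.Iic l, m a + if i ≤ l ∧ l < j then 1 else 0 := by
  have key : ∀ a, (transfer m i j a : ℤ) =
      m a + (if a = i then 1 else 0) - (if a = j then 1 else 0) := by
    intro a
    by_cases hi : a = i
    · subst hi
      rw [transfer_left m hij.ne]
      simp [hij.ne]
    · by_cases hj' : a = j
      · subst hj'
        rw [transfer_right]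
        simp [hi]
        omega
      · rw [transfer_of_ne m hi hj']
        simp [hi, hj']
  zify
  simp only [key, Finset.sum_sub_distrib, Finset.sum_add_distrib, Finset.sum_ite_eq',
    Finset.mem_Iic]
  by_cases h1 : i ≤ l <;> by_cases h2 : j ≤ l
  · simp [h1, h2, not_lt.2 h2]
  · simp [h1, h2, not_le.1 h2]
  · exact absurd (hij.le.trans h2) h1
  · simp [h1, h2]

theorem sum_Iic_eq_add_Iio (f : Fin k → ℕ) (j : Fin k) :
    ∑ a ∈ Finset.Iic j, f a = f j + ∑ a ∈ Finset.Iio j, f a := by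
  rw [← Finset.Iio_insert, Finset.sum_insert (by simp)]

theorem eq_of_sum_Iic_eq {n m : Fin k → ℕ}
    (h : ∀ j, ∑ i ∈ Finset.Iic j, n i = ∑ i ∈ Finset.Iic j, m i) : n = m := by
  funext j
  induction j using WellFoundedLT.induction with
  | ind j ih =>
    have hj := h j
    have hlt : ∑ a ∈ Finset.Iio j, n a = ∑ a ∈ Finset.Iio j, m a :=
      Finset.sum_congr rfl fun a ha => ih a (Finset.mem_Iio.1 ha)
    rw [sum_Iic_eq_add_Iio, sum_Iic_eq_add_Iio] at hj
    omega

theorem sum_Iio_eq_sum_Iic_pred (f : Fin k → ℕ) {i j : Fin k} (hij : (i : ℕ) + 1 = j) :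
    ∑ a ∈ Finset.Iio j, f a = ∑ a ∈ Finset.Iic i, f a := by
  congr 1
  ext a
  simp only [Finset.mem_Iio, Finset.mem_Iic, Fin.lt_def, Fin.le_def]
  omega

/-- Take i the first index where n and m differ, and j the first later index where the partial sums
agree again. Between them dominance is strict, so a unit can be spared. Monotonicity survives at i
since m_{i-1} = n_{i-1} ≥ n_i > m_i, and at j since m_j > n_j ≥ n_{j+1} ≥ m_{j+1}. -/
theorem exists_transfer {n m : Fin k → ℕ} (hn : Antitone n) (hm : Antitone m)
    (hn2 : ∀ i, 2 ≤ n i) (hm2 : ∀ i, 2 ≤ m i) (hsum : ∑ i, n i = ∑ i, m i)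
    (hdom : Dominates n m) (hne : n ≠ m) :
    ∃ i j, i < j ∧ Antitone (transfer m i j) ∧ (∀ l, 2 ≤ transfer m i j l) ∧
      Dominates n (transfer m i j) := by
  classical
  have hex : ∃ a : ℕ, ∃ h : a < k, n ⟨a, h⟩ ≠ m ⟨a, h⟩ := by
    by_contra! h
    exact hne (funext fun a => h a a.2)
  obtain ⟨hik, hi⟩ := Nat.find_spec hex
  have himin : ∀ l : Fin k, (l : ℕ) < Nat.find hex → n l = m l := by
    intro l hl
    by_contra h
    exact Nat.find_min hex hl ⟨l.2, h⟩
  obtain ⟨i, hidef⟩ : ∃ i : Fin k, i = ⟨Nat.find hex, hik⟩ := ⟨_, rfl⟩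
  rw [← hidef] at hi
  replace himin : ∀ l, l < i → n l = m l := fun l hl => himin l (by rw [hidef] at hl; exact hl)
  have hIio : ∑ a ∈ Finset.Iio i, n a = ∑ a ∈ Finset.Iio i, m a :=
    Finset.sum_congr rfl fun a ha => himin a (Finset.mem_Iio.1 ha)
  have hilt : m i < n i := by
    have := hdom i
    rw [sum_Iic_eq_add_Iio, sum_Iic_eq_add_Iio] at this
    omega
  -- The last index qualifies because the totals agree.
  have hexj : ∃ b : ℕ, ∃ h : b < k, i < ⟨b, h⟩ ∧
      ∑ a ∈ Finset.Iic (⟨b, h⟩ : Fin k), n a = ∑ a ∈ Finset.Iic (⟨b, h⟩ : Fin k), m a := by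
    have hk : k - 1 < k := by have := i.2; omega
    have hIic : Finset.Iic (⟨k - 1, hk⟩ : Fin k) = Finset.univ := by
      ext a
      simp only [Finset.mem_Iic, Fin.le_def, Finset.mem_univ, iff_true]
      have := a.2
      omega
    refine ⟨k - 1, hk, ?_, by rw [hIic, hsum]⟩
    by_contra h
    have hieq : i = ⟨k - 1, hk⟩ := by
      ext
      simp only [Fin.lt_def] at h
      have := i.2
      simp only
      omega
    rw [← hieq] at hIic
    have h1 := sum_Iic_eq_add_Iio n i
    have h2 := sum_Iic_eq_add_Iio m i
    rw [hIic] at h1 h2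
    omega
  obtain ⟨hjk, hij, hjeq⟩ := Nat.find_spec hexj
  have hjmin : ∀ l : Fin k, i < l → (l : ℕ) < Nat.find hexj →
      ∑ a ∈ Finset.Iic l, n a ≠ ∑ a ∈ Finset.Iic l, m a :=
    fun l hil hl h => Nat.find_min hexj hl ⟨l.2, hil, h⟩
  obtain ⟨j, hjdef⟩ : ∃ j : Fin k, j = ⟨Nat.find hexj, hjk⟩ := ⟨_, rfl⟩
  rw [← hjdef] at hij hjeq
  replace hjmin : ∀ l, i ≤ l → l < j →
      ∑ a ∈ Finset.Iic l, m a < ∑ a ∈ Finset.Iic l, n a := by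
    intro l hil hlj
    rcases eq_or_lt_of_le hil with rfl | hil
    · rw [sum_Iic_eq_add_Iio, sum_Iic_eq_add_Iio]
      omega
    · exact lt_of_le_of_ne (hdom l) (hjmin l hil (by rw [hjdef] at hlj; exact hlj)).symm
  have hjlt : n j < m j := by
    have hj0 : (j : ℕ) - 1 < k := by have := j.2; omega
    have hijv : (i : ℕ) < j := hij
    have hlt := hjmin ⟨j - 1, hj0⟩ (by simp only [Fin.le_def]; omega)
      (by simp only [Fin.lt_def]; omega)
    rw [← sum_Iio_eq_sum_Iic_pred n (j := j) (by simp only; omega),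
      ← sum_Iio_eq_sum_Iic_pred m (j := j) (by simp only; omega)] at hlt
    rw [sum_Iic_eq_add_Iio, sum_Iic_eq_add_Iio] at hjeq
    omega
  have hnext : ∀ l, j < l → m l ≤ n j := by
    intro l hl
    have hs : (j : ℕ) + 1 < k := by have h1 := l.2; have h2 : (j : ℕ) < l := hl; omega
    have h1 := hdom ⟨j + 1, hs⟩
    rw [sum_Iic_eq_add_Iio, sum_Iic_eq_add_Iio, sum_Iio_eq_sum_Iic_pred n (i := j) rfl,
      sum_Iio_eq_sum_Iic_pred m (i := j) rfl] at h1
    have h2 : n ⟨j + 1, hs⟩ ≤ n j := hn (by simp [Fin.le_def])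
    have h3 : m l ≤ m ⟨j + 1, hs⟩ := hm hl
    omega
  have hprev : ∀ l, l < i → m i + 1 ≤ m l := by
    intro l hl
    have h1 := himin l hl
    have h2 : n i ≤ n l := hn hl.le
    omega
  refine ⟨i, j, hij, ?_, ?_, ?_⟩
  · intro a b hab
    rcases eq_or_lt_of_le hab with rfl | hab
    · exact le_rfl
    have hmab := hm hab.le
    have h2 := hn2 j
    by_cases hbi : b = i
    · subst hbi
      rw [transfer_left m hij.ne, transfer_of_ne m hab.ne (hab.trans hij).ne]
      exact hprev a hab
    by_cases hbj : b = j
    · subst hbj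
      rw [transfer_right]
      by_cases hai : a = i
      · subst hai
        rw [transfer_left m hij.ne]
        omega
      · rw [transfer_of_ne m hai hab.ne]
        omega
    rw [transfer_of_ne m hbi hbj]
    by_cases hai : a = i
    · subst hai
      rw [transfer_left m hij.ne]
      omega
    by_cases haj : a = j
    · subst haj
      rw [transfer_right]
      have := hnext b hab
      omega
    rw [transfer_of_ne m hai haj]
    exact hmab
  · intro l
    have h2 := hn2 j
    by_cases hli : l = i
    · subst hli
      rw [transfer_left m hij.ne]
      linarith [hm2 l]
    by_cases hlj : l = j
    · subst hlj
      rw [transfer_right]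
      omega
    rw [transfer_of_ne m hli hlj]
    exact hm2 l
  · intro l
    rw [sum_Iic_transfer m hij (by linarith [hm2 j])]
    have h1 := hdom l
    split_ifs with h
    · exact hjmin l h.1 h.2
    · exact h1

theorem sum_transfer (m : Fin k → ℕ) {i j : Fin k} (hij : i < j) (hj : 1 ≤ m j) :
    ∑ l, transfer m i j l = ∑ l, m l := by
  have hk : k - 1 < k := by have := i.2; omega
  have hIic : Finset.Iic (⟨k - 1, hk⟩ : Fin k) = Finset.univ := by
    ext a
    simp only [Finset.mem_Iic, Fin.le_def, Finset.mem_univ, iff_true]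
    have := a.2
    omega
  have h := sum_Iic_transfer m hij hj ⟨k - 1, hk⟩
  rw [hIic, if_neg, add_zero] at h
  · exact h
  · rintro ⟨-, h⟩
    simp only [Fin.lt_def] at h
    have := j.2
    omega

/-- Induction on a bound `d` for the total gap between partial sums, which every transfer shrinks.
Strictness comes from the first transfer alone. -/
theorem starValue_le_of_dominates {n : Fin k → ℕ} (hn : Antitone n) (hn2 : ∀ i, 2 ≤ n i)
    {y : ℝ} (d : ℕ) {m : Fin k → ℕ} (hm : Antitone m) (hm2 : ∀ i, 2 ≤ m i)
    (hsum : ∑ i, n i = ∑ i, m i) (hdom : Dominates n m)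
    (hd : ∑ l, ∑ a ∈ Finset.Iic l, n a ≤ ∑ l, ∑ a ∈ Finset.Iic l, m a + d)
    (h : ∀ z ∈ Set.Icc y 0, 0 ≤ starValue m z) {z : ℝ} (hz : z ∈ Set.Icc y 0) :
    starValue m z ≤ starValue n z ∧
      (3 ≤ k → n ≠ m → z < 0 → starValue m z < starValue n z) := by
  induction d generalizing m with
  | zero =>
    have heq : n = m := by
      refine eq_of_sum_Iic_eq fun j => ?_
      have h1 := (Finset.sum_eq_sum_iff_of_le (s := Finset.univ) fun j _ => hdom j).1
        (le_antisymm (Finset.sum_le_sum fun j _ => hdom j) hd)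
      exact (h1 j (Finset.mem_univ j)).symm
    subst heq
    exact ⟨le_rfl, fun _ hne => absurd rfl hne⟩
  | succ d ih =>
    by_cases hne : n = m
    · subst hne
      exact ⟨le_rfl, fun _ hne => absurd rfl hne⟩
    obtain ⟨i, j, hij, hanti, h2, hdom'⟩ := exists_transfer hn hm hn2 hm2 hsum hdom hne
    have hj1 : 1 ≤ m j := by linarith [hm2 j]
    have hstep : ∀ u ∈ Set.Icc y 0, _ := fun u hu =>
      starValue_le_transfer hm2 h hij.ne (hm hij.le) hu
    have hlt : ∑ l, ∑ a ∈ Finset.Iic l, m a <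
        ∑ l, ∑ a ∈ Finset.Iic l, transfer m i j a := by
      refine Finset.sum_lt_sum (fun l _ => ?_) ⟨i, Finset.mem_univ i, ?_⟩
      · rw [sum_Iic_transfer m hij hj1]
        exact Nat.le_add_right _ _
      · rw [sum_Iic_transfer m hij hj1, if_pos ⟨le_rfl, hij⟩]
        exact Nat.lt_succ_self _
    have hrec := ih hanti h2 (by rw [sum_transfer m hij hj1, hsum]) hdom' (by omega)
      (fun u hu => (h u hu).trans (hstep u hu).1)
    exact ⟨(hstep z hz).1.trans hrec.1,
      fun hk _ hz0 => ((hstep z hz).2 hk hz0).trans_le hrec.1⟩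

end StarValue

/-! ### Independence polynomials of starlike trees -/

section IndependencePolynomial

open Classical in
-- Boolean indicators replace vertex sets so that the sum can be split over the centre and the arms.
theorem eval_indepPoly {V : Type*} [Fintype V] [DecidableEq V] (G : SimpleGraph V) (x : ℝ) :
    (indepPoly G).eval x =
      ∑ f : V → Bool, if ∀ u v, G.Adj u v → ¬(f u = true ∧ f v = true) then
        ∏ v, (if f v = true then x else 1) else 0 := by
  have h1 : (indepPoly G).eval x =
      ∑ s : Finset V, if G.IsIndepSet (s : Set V) then x ^ s.card else 0 := by
    rw [← Finset.sum_filter, ← Finset.sum_fiberwise_of_maps_to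
      (t := Finset.range (Fintype.card V + 1)) (g := Finset.card)
      (fun s _ => Finset.mem_range.2 (Nat.lt_succ_of_le (Finset.card_le_univ s)))]
    simp only [indepPoly, Polynomial.eval_finsetSum, Polynomial.eval_mul, Polynomial.eval_C,
      Polynomial.eval_pow, Polynomial.eval_X]
    refine Finset.sum_congr rfl fun k _ => ?_
    rw [Finset.sum_congr rfl (g := fun _ => x ^ k)
      (fun s hs => by rw [(Finset.mem_filter.1 hs).2]), Finset.sum_const, nsmul_eq_mul]
    congr 3
    ext s
    simp [SimpleGraph.mem_indepSetFinset_iff, SimpleGraph.isNIndepSet_iff]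
  rw [h1]
  refine Fintype.sum_bijective (fun (s : Finset V) (v : V) => decide (v ∈ s)) ?_ _ _ fun s => ?_
  · refine ⟨fun s t h => ?_, fun f => ⟨Finset.univ.filter fun v => f v = true, ?_⟩⟩
    · ext v
      simpa using congrFun h v
    · funext v
      simp
  · simp only [decide_eq_true_eq]
    congr 1
    · refine propext ⟨fun h u v huv hs => h hs.1 hs.2 huv.ne huv, fun h u hu v hv _ huv => ?_⟩
      exact h u v huv ⟨hu, hv⟩
    · rw [Finset.prod_ite_mem]
      simp

theorem eval_indepPoly_congr {V W : Type*} [Fintype V] [Fintype W] {G : SimpleGraph V}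
    {H : SimpleGraph W} (e : G ≃g H) (x : ℝ) :
    (indepPoly G).eval x = (indepPoly H).eval x := by
  classical
  rw [eval_indepPoly, eval_indepPoly]
  refine Fintype.sum_equiv (e.toEquiv.arrowCongr (Equiv.refl Bool)) _ _ fun f => ?_
  have hf : ∀ v, e.toEquiv.arrowCongr (Equiv.refl Bool) f (e v) = f v := fun v =>
    congrArg f (e.toEquiv.symm_apply_apply v)
  congr 1
  · refine propext ⟨fun h u v huv => ?_, fun h u v huv => ?_⟩
    · exact h _ _ (e.symm.map_adj_iff.2 huv)
    · have := h _ _ (e.map_adj_iff.2 huv)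
      rwa [hf, hf] at this
  · refine Fintype.prod_equiv e.toEquiv _ _ fun v => ?_
    exact congrArg (fun c : Bool => if c = true then x else 1) (hf v).symm

/-- Whether `f` selects an independent set in a path with vertices `0, …, N - 1`, which has to
avoid the vertex `0` if `b` is true. -/
def PathIndep (b : Bool) {N : ℕ} (f : Fin N → Bool) : Prop :=
  (∀ a : Fin N, (a : ℕ) = 0 → ¬(b = true ∧ f a = true)) ∧
    ∀ a c : Fin N, (c : ℕ) = a + 1 → ¬(f a = true ∧ f c = true)

theorem pathIndep_cons (b c : Bool) {N : ℕ} (f : Fin N → Bool) :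
    PathIndep b (Fin.cons c f : Fin (N + 1) → Bool) ↔
      ¬(b = true ∧ c = true) ∧ PathIndep c f := by
  unfold PathIndep
  simp only [Fin.forall_fin_succ, Fin.cons_zero, Fin.cons_succ, Fin.val_zero, Fin.val_succ]
  constructor
  · rintro ⟨⟨h1, -⟩, ⟨-, h2⟩, h3⟩
    exact ⟨h1 trivial, fun a ha => h2 a (by simp [ha]), fun a d had => (h3 a).2 d (by omega)⟩
  · rintro ⟨h1, h2, h3⟩
    refine ⟨⟨fun _ => h1, fun a ha => by omega⟩, ⟨fun h => by omega, fun a ha => h2 a (by omega)⟩,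
      fun a => ⟨fun h => by omega, fun d had => h3 a d (by omega)⟩⟩

open Classical in
-- Conditioning on the first vertex reproduces the recursion: selecting it costs a factor x and
-- forbids the next one.
theorem sum_pathIndep (x : ℝ) (b : Bool) (N : ℕ) :
    (∑ f : Fin N → Bool, if PathIndep b f then ∏ a, (if f a = true then x else 1) else 0) =
      pathValue x (if b = true then N else N + 1) := by
  induction N generalizing b with
  | zero => cases b <;> simp [PathIndep, pathValue]
  | succ N ih =>
    rw [← (Fin.consEquiv fun _ => Bool).sum_comp, Fintype.sum_prod_type]
    simp only [Fin.consEquiv, Equiv.coe_fn_mk, pathIndep_cons, Fin.prod_univ_succ,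
      Fin.cons_zero, Fin.cons_succ, Fintype.sum_bool]
    have ht := ih true
    have hf := ih false
    cases b
    · simp only [Bool.false_eq_true, false_and, not_false_eq_true, true_and, if_true, if_false,
        one_mul] at ht hf ⊢
      rw [hf, pathValue_add_two, ← ht, Finset.mul_sum, add_comm]
      simp only [mul_ite, mul_zero]
    · simpa using hf

theorem starlikeTree_indep_iff {k : ℕ} (n : Fin k → ℕ) (b : Bool)
    (g : (Σ i : Fin k, Fin (n i - 1)) → Bool) :
    (∀ u v, (starlikeTree n).Adj u v →
        ¬((u.elim b g : Bool) = true ∧ (v.elim b g : Bool) = true)) ↔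
      ∀ i, PathIndep b fun a => g ⟨i, a⟩ := by
  constructor
  · intro h i
    refine ⟨fun a ha => ?_, fun a c hac => ?_⟩
    · exact h none (some ⟨i, a⟩) ⟨by simp, Or.inl ha⟩
    · refine h (some ⟨i, a⟩) (some ⟨i, c⟩) ⟨?_, Or.inl ⟨rfl, hac⟩⟩
      intro hEq
      have : a = c := by simpa using hEq
      subst this
      omega
  · intro h
    have hstep : ∀ u v, StarlikeStep n u v →
        ¬((u.elim b g : Bool) = true ∧ (v.elim b g : Bool) = true) := by
      rintro (_ | ⟨i, a⟩) (_ | ⟨j, c⟩) huv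
      · exact huv.elim
      · exact (h j).1 c huv
      · exact huv.elim
      · obtain ⟨hij, hac⟩ := huv
        simp only at hij
        subst hij
        exact (h i).2 a c hac
    rintro u v ⟨-, huv | huv⟩
    · exact hstep u v huv
    · exact fun hs => hstep v u huv hs.symm

theorem eval_indepPoly_starlikeTree {k : ℕ} (n : Fin k → ℕ) (hn : ∀ i, 2 ≤ n i) (x : ℝ) :
    (indepPoly (starlikeTree n)).eval x = starValue n x := by
  classical
  -- Once the state `b` of the centre is fixed, the arms are independent and the sum factorises.
  have harms : ∀ b : Bool, (∑ g : (Σ i : Fin k, Fin (n i - 1)) → Bool,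
      if ∀ i, PathIndep b (fun a => g ⟨i, a⟩) then ∏ p, (if g p = true then x else 1) else 0) =
      ∏ i, pathValue x (if b = true then n i - 1 else n i - 1 + 1) := by
    intro b
    simp only [← sum_pathIndep]
    rw [Finset.prod_univ_sum, Fintype.piFinset_univ]
    refine Fintype.sum_equiv (Equiv.piCurry fun _ _ => Bool) _ _ fun g => ?_
    rw [Fintype.prod_sigma]
    by_cases h : ∀ i, PathIndep b (fun a => g ⟨i, a⟩)
    · rw [if_pos h]
      exact Finset.prod_congr rfl fun i _ => (if_pos (h i)).symm
    · rw [if_neg h]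
      push Not at h
      obtain ⟨i, hi⟩ := h
      exact (Finset.prod_eq_zero (Finset.mem_univ i) (if_neg hi)).symm
  rw [eval_indepPoly]
  have hsplit : ∀ F : (StarlikeVertex n → Bool) → ℝ,
      ∑ f, F f = ∑ b : Bool, ∑ g : (Σ i : Fin k, Fin (n i - 1)) → Bool,
        F (fun u => u.elim b g) := by
    intro F
    rw [← Fintype.sum_prod_type' (f := fun b g => F (fun u => u.elim b g))]
    refine Fintype.sum_equiv (Equiv.piOptionEquivProd (β := fun _ => Bool)) _ _ fun f => ?_
    congr 1
    funext u
    cases u <;> rfl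
  rw [hsplit]
  simp only [starlikeTree_indep_iff, Fintype.prod_option, Option.elim_none, Option.elim_some,
    Fintype.sum_bool, ← mul_ite_zero, ← Finset.mul_sum]
  have hn1 : ∀ i, n i - 1 + 1 = n i := fun i => Nat.sub_add_cancel (by linarith [hn i])
  convert congrArg₂ (fun s t => x * s + t) (harms true) (harms false) using 1
  · simp only [if_true, Bool.false_eq_true, if_false, one_mul]
    congr!
  · simp [hn1, starValue, add_comm]

end IndependencePolynomial

theorem card_starlikeVertex {k : ℕ} (n : Fin k → ℕ) (hn : ∀ i, 2 ≤ n i) :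
    Fintype.card (StarlikeVertex n) + k = ∑ i, n i + 1 := by
  have h : ∑ i, n i = ∑ i, (n i - 1) + k := by
    rw [Finset.sum_congr rfl fun i _ => (Nat.sub_add_cancel (by linarith [hn i] : 1 ≤ n i)).symm,
      Finset.sum_add_distrib]
    simp
  rw [Fintype.card_option, Fintype.card_sigma]
  simp only [Fintype.card_fin]
  omega

end StarlikeTrees

theorem mainTheorem3 {k : ℕ} (n m : Fin k → ℕ)
    (hn : Antitone n) (hm : Antitone m)
    (hn2 : ∀ i, 2 ≤ n i) (hm2 : ∀ i, 2 ≤ m i)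
    {V W : Type*} [Fintype V] [Fintype W]
    (T₁ : SimpleGraph V) (T₂ : SimpleGraph W)
    (hT₁ : Nonempty (T₁ ≃g StarlikeTrees.starlikeTree n))
    (hT₂ : Nonempty (T₂ ≃g StarlikeTrees.starlikeTree m))
    (horder : Fintype.card V = Fintype.card W) :
    (StarlikeTrees.Dominates n m → StarlikeTrees.GraphGE T₂ T₁) ∧
      (3 ≤ k → StarlikeTrees.StrictlyDominates n m → StarlikeTrees.GraphGT T₂ T₁) := by
  open StarlikeTrees in
  obtain ⟨e₁⟩ := hT₁
  obtain ⟨e₂⟩ := hT₂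
  have hP₁ : ∀ x, (indepPoly T₁).eval x = starValue n x := fun x =>
    (eval_indepPoly_congr e₁ x).trans (eval_indepPoly_starlikeTree n hn2 x)
  have hP₂ : ∀ x, (indepPoly T₂).eval x = starValue m x := fun x =>
    (eval_indepPoly_congr e₂ x).trans (eval_indepPoly_starlikeTree m hm2 x)
  have hsum : ∑ i, n i = ∑ i, m i := by
    have h1 := card_starlikeVertex n hn2
    have h2 := card_starlikeVertex m hm2
    rw [← Fintype.card_congr e₁.toEquiv] at h1
    rw [← Fintype.card_congr e₂.toEquiv] at h2
    omega
  obtain ⟨ξ, hξ0, hξ, hnn⟩ := exists_largest_zero_starValue hm2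
  have hcmp : Dominates n m → ∀ z ∈ Set.Icc ξ 0, starValue m z ≤ starValue n z ∧
      (3 ≤ k → n ≠ m → z < 0 → starValue m z < starValue n z) := fun hdom z hz =>
    starValue_le_of_dominates hn hn2 _ hm hm2 hsum hdom (Nat.le_add_left _ _) hnn hz
  have hGE : Dominates n m → GraphGE T₂ T₁ := by
    refine fun hdom => ⟨ξ, ?_, fun x hx => ?_⟩
    · simpa only [IsLargestRealRoot, Polynomial.IsRoot.def, hP₂] using hξ
    · rw [hP₁, hP₂]
      exact (hcmp hdom x hx).1
  refine ⟨hGE, fun hk hdom => ⟨hGE hdom.1, fun heq => ?_⟩⟩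
  -- The polynomials already differ at ξ, which is negative.
  have hlt := (hcmp hdom.1 ξ ⟨le_rfl, hξ0.le⟩).2 hk hdom.2 hξ0
  rw [← hP₁, ← hP₂, heq] at hlt
  exact lt_irrefl _ hlt
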